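/- Let $\mathbb K$ be $\mathbb R$ or $\mathbb C$, let $X_1,X_2$ be pointed metric spaces with base points denoted $0$, and let $E$ be a Banach space over $\mathbb K$ with dual space $E^*$. A map $T:X_1\times X_2\to E$ is a two-Lipschitz operator if $T(x_1,0)=T(0,x_2)=0$ for all $x_1\in X_1$, $x_2\in X_2$ and there is a constant $C>0$ with $$\|T(x_1,x_2)-T(x_1,x_2')-T(x_1',x_2)+T(x_1',x_2')\|\le C\,d(x_1,x_1')\,d(x_2,x_2')\qquad(x_1,x_1'\in X_1,\ x_2,x_2'\in X_2).$$ The space $BLip_0(X_1,X_2;E)$ of all these maps carries the norm $$BLip(T)=\sup_{x_1\ne x_1',\,x_2\ne x_2'}\frac{\|T(x_1,x_2)-T(x_1,x_2')-T(x_1',x_2)+T(x_1',x_2')\|}{d(x_1,x_1')\,d(x_2,x_2')}$$ (the supremum of the empty set being $0$). The operator $T$ is called compact if the set $$Im_{BLip}(T)=\left\{\frac{T(x_1,x_2)-T(x_1,x_2')-T(x_1',x_2)+T(x_1',x_2')}{d(x_1,x_1')\,d(x_2,x_2')}\ :\ x_1\ne x_1'\in X_1,\ x_2\ne x_2'\in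 X_2\right\}$$ is relatively compact in $E$. The transpose of $T$ is the bounded linear operator $T^t:E^*\to BLip_0(X_1,X_2;\mathbb K)$, $T^t(e^*)=e^*\circ T$. **Corollary.** A two-Lipschitz operator $T\in BLip_0(X_1,X_2;E)$ is compact if and only if its transpose $T^t:E^*\to BLip_0(X_1,X_2;\mathbb K)$ is a compact linear operator. -/

import Mathlib

universe u v w

/-- The mixed second difference
`T (x₁, x₂) - T (x₁, x₂') - T (x₁', x₂) + T (x₁', x₂')` of a map `T : X₁ × X₂ → E`. -/
def mixedDiff {X₁ : Type u} {X₂ : Type v} {E : Type w} [AddCommGroup E]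
    (T : X₁ × X₂ → E) (x₁ x₁' : X₁) (x₂ x₂' : X₂) : E :=
  T (x₁, x₂) - T (x₁, x₂') - T (x₁', x₂) + T (x₁', x₂')

theorem mixedDiff_smul {𝕜 : Type*} [RCLike 𝕜] {X₁ : Type u} {X₂ : Type v} {E : Type w}
    [NormedAddCommGroup E] [NormedSpace 𝕜 E]
    (c : 𝕜) (T : X₁ × X₂ → E) (x₁ x₁' : X₁) (x₂ x₂' : X₂) :
    mixedDiff (fun x => c • T x) x₁ x₁' x₂ x₂' = c • mixedDiff T x₁ x₁' x₂ x₂' := by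
  simp only [mixedDiff, smul_sub, smul_add]

/-- Two-Lipschitz operators `X₁ × X₂ → E`. A pointed metric space is a metric space with a
distinguished point, which is written `0` (no relation with the metric is required). -/
@[ext]
structure BLip₀ (X₁ : Type u) (X₂ : Type v) (E : Type w) [MetricSpace X₁] [Zero X₁]
    [MetricSpace X₂] [Zero X₂] [NormedAddCommGroup E] where
  toFun : X₁ × X₂ → E
  exists_bound : ∃ C : ℝ, 0 < C ∧ ∀ (x₁ x₁' : X₁) (x₂ x₂' : X₂),
    ‖mixedDiff toFun x₁ x₁' x₂ x₂'‖ ≤ C * dist x₁ x₁' * dist x₂ x₂'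
  map_zero_right : ∀ x₁ : X₁, toFun (x₁, 0) = 0
  map_zero_left : ∀ x₂ : X₂, toFun (0, x₂) = 0

namespace BLip₀

section Basic

variable {X₁ : Type u} {X₂ : Type v} {E : Type w} [MetricSpace X₁] [Zero X₁]
  [MetricSpace X₂] [Zero X₂] [NormedAddCommGroup E]

instance : CoeFun (BLip₀ X₁ X₂ E) (fun _ => X₁ × X₂ → E) := ⟨BLip₀.toFun⟩

instance : Zero (BLip₀ X₁ X₂ E) :=
  ⟨{ toFun := fun _ => 0
     exists_bound := ⟨1, one_pos, fun x₁ x₁' x₂ x₂' => by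
       simp only [mixedDiff, sub_zero, add_zero, norm_zero]; positivity⟩
     map_zero_right := fun _ => rfl
     map_zero_left := fun _ => rfl }⟩

instance : Add (BLip₀ X₁ X₂ E) :=
  ⟨fun S T =>
   { toFun := fun x => S x + T x
     exists_bound := by
       obtain ⟨C, hC, hS⟩ := S.exists_bound
       obtain ⟨D, hD, hT⟩ := T.exists_bound
       refine ⟨C + D, add_pos hC hD, fun x₁ x₁' x₂ x₂' => ?_⟩
       have h : mixedDiff (fun x => S x + T x) x₁ x₁' x₂ x₂'
           = mixedDiff S x₁ x₁' x₂ x₂' + mixedDiff T x₁ x₁' x₂ x₂' := by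
         simp only [mixedDiff]; abel
       rw [h]
       refine (norm_add_le _ _).trans ?_
       linarith [hS x₁ x₁' x₂ x₂', hT x₁ x₁' x₂ x₂']
     map_zero_right := fun x => by simp [S.map_zero_right, T.map_zero_right]
     map_zero_left := fun x => by simp [S.map_zero_left, T.map_zero_left] }⟩

instance : Neg (BLip₀ X₁ X₂ E) :=
  ⟨fun T =>
   { toFun := fun x => -T x
     exists_bound := by
       obtain ⟨C, hC, hT⟩ := T.exists_bound
       refine ⟨C, hC, fun x₁ x₁' x₂ x₂' => ?_⟩
       have h : mixedDiff (fun x => -T x) x₁ x₁' x₂ x₂' = -mixedDiff T x₁ x₁' x₂ x₂' := by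
         simp only [mixedDiff]; abel
       rw [h, norm_neg]
       exact hT x₁ x₁' x₂ x₂'
     map_zero_right := fun x => by simp [T.map_zero_right]
     map_zero_left := fun x => by simp [T.map_zero_left] }⟩

@[simp] theorem zero_apply (x : X₁ × X₂) : (0 : BLip₀ X₁ X₂ E) x = 0 := rfl
@[simp] theorem add_apply (S T : BLip₀ X₁ X₂ E) (x : X₁ × X₂) : (S + T) x = S x + T x := rfl
@[simp] theorem neg_apply (T : BLip₀ X₁ X₂ E) (x : X₁ × X₂) : (-T) x = -T x := rfl

instance : AddCommGroup (BLip₀ X₁ X₂ E) where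
  add_assoc R S T := by ext x; exact add_assoc _ _ _
  zero_add T := by ext x; exact zero_add _
  add_zero T := by ext x; exact add_zero _
  add_comm S T := by ext x; exact add_comm _ _
  neg_add_cancel T := by ext x; exact neg_add_cancel _
  nsmul := nsmulRec
  zsmul := zsmulRec

/-- The set of the quotients whose supremum is `BLip T`. -/
def quotients (T : BLip₀ X₁ X₂ E) : Set ℝ :=
  {r | ∃ (x₁ x₁' : X₁) (x₂ x₂' : X₂), x₁ ≠ x₁' ∧ x₂ ≠ x₂' ∧
    r = ‖mixedDiff T x₁ x₁' x₂ x₂'‖ / (dist x₁ x₁' * dist x₂ x₂')}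

/-- The two-Lipschitz norm on the space of two-Lipschitz operators (equal to `0` if one of the
two spaces has only one point, in which case `0` is the only two-Lipschitz operator). -/
noncomputable instance : Norm (BLip₀ X₁ X₂ E) := ⟨fun T => sSup T.quotients⟩

theorem norm_def (T : BLip₀ X₁ X₂ E) : ‖T‖ = sSup T.quotients := rfl

theorem bddAbove_quotients (T : BLip₀ X₁ X₂ E) : BddAbove T.quotients := by
  obtain ⟨C, _, hT⟩ := T.exists_bound
  refine ⟨C, ?_⟩
  rintro r ⟨x₁, x₁', x₂, x₂', h₁, h₂, rfl⟩
  rw [div_le_iff₀ (mul_pos (dist_pos.2 h₁) (dist_pos.2 h₂)), ← mul_assoc]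
  exact hT x₁ x₁' x₂ x₂'

theorem norm_nonneg' (T : BLip₀ X₁ X₂ E) : 0 ≤ ‖T‖ := by
  refine Real.sSup_nonneg ?_
  rintro r ⟨x₁, x₁', x₂, x₂', _, _, rfl⟩
  positivity

theorem norm_mixedDiff_le (T : BLip₀ X₁ X₂ E) (x₁ x₁' : X₁) (x₂ x₂' : X₂) :
    ‖mixedDiff T x₁ x₁' x₂ x₂'‖ ≤ ‖T‖ * (dist x₁ x₁' * dist x₂ x₂') := by
  rcases eq_or_ne x₁ x₁' with rfl | h₁
  · simp [mixedDiff]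
  rcases eq_or_ne x₂ x₂' with rfl | h₂
  · simp [mixedDiff]
  rw [← div_le_iff₀ (mul_pos (dist_pos.2 h₁) (dist_pos.2 h₂))]
  exact le_csSup T.bddAbove_quotients ⟨x₁, x₁', x₂, x₂', h₁, h₂, rfl⟩

theorem norm_le_of_bound (T : BLip₀ X₁ X₂ E) {C : ℝ} (hC : 0 ≤ C)
    (h : ∀ (x₁ x₁' : X₁) (x₂ x₂' : X₂),
      ‖mixedDiff T x₁ x₁' x₂ x₂'‖ ≤ C * (dist x₁ x₁' * dist x₂ x₂')) : ‖T‖ ≤ C := by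
  refine Real.sSup_le ?_ hC
  rintro r ⟨x₁, x₁', x₂, x₂', h₁, h₂, rfl⟩
  rw [div_le_iff₀ (mul_pos (dist_pos.2 h₁) (dist_pos.2 h₂))]
  exact h x₁ x₁' x₂ x₂'

theorem mixedDiff_zero_zero (T : BLip₀ X₁ X₂ E) (x₁ : X₁) (x₂ : X₂) :
    mixedDiff T x₁ 0 x₂ 0 = T (x₁, x₂) := by
  simp [mixedDiff, T.map_zero_left, T.map_zero_right]

noncomputable instance : NormedAddCommGroup (BLip₀ X₁ X₂ E) :=
  AddGroupNorm.toNormedAddCommGroup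
    { toFun := fun T => ‖T‖
      map_zero' := le_antisymm
        (norm_le_of_bound _ le_rfl fun x₁ x₁' x₂ x₂' => by simp [mixedDiff]) (norm_nonneg' _)
      add_le' := fun S T => by
        refine norm_le_of_bound _ (add_nonneg S.norm_nonneg' T.norm_nonneg')
          fun x₁ x₁' x₂ x₂' => ?_
        have h : mixedDiff (S + T) x₁ x₁' x₂ x₂'
            = mixedDiff S x₁ x₁' x₂ x₂' + mixedDiff T x₁ x₁' x₂ x₂' := by
          simp only [mixedDiff, add_apply]; abel
        rw [h, add_mul]
        exact (norm_add_le _ _).trans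
          (add_le_add (S.norm_mixedDiff_le _ _ _ _) (T.norm_mixedDiff_le _ _ _ _))
      neg' := fun T => by
        have h : (-T).quotients = T.quotients := by
          have h' : ∀ (x₁ x₁' : X₁) (x₂ x₂' : X₂),
              ‖mixedDiff (-T) x₁ x₁' x₂ x₂'‖ = ‖mixedDiff T x₁ x₁' x₂ x₂'‖ := by
            intro x₁ x₁' x₂ x₂'
            rw [← norm_neg]
            congr 1
            simp only [mixedDiff, neg_apply]; abel
          simp only [quotients, h']
        simp only [norm_def, h]
      eq_zero_of_map_eq_zero' := fun T hT => by
        ext ⟨x₁, x₂⟩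
        have h := T.norm_mixedDiff_le x₁ 0 x₂ 0
        change ‖T‖ = 0 at hT
        rw [hT, zero_mul, mixedDiff_zero_zero] at h
        exact norm_le_zero_iff.1 h }

end Basic

section Scalars

variable {𝕜 : Type*} [RCLike 𝕜] {X₁ : Type u} {X₂ : Type v} {E : Type w}
  [MetricSpace X₁] [Zero X₁] [MetricSpace X₂] [Zero X₂] [NormedAddCommGroup E] [NormedSpace 𝕜 E]

/-- Composition `e ∘ T` of a two-Lipschitz operator with a continuous linear functional. -/
def compDual (e : StrongDual 𝕜 E) (T : BLip₀ X₁ X₂ E) : BLip₀ X₁ X₂ 𝕜 where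
  toFun := fun x => e (T x)
  exists_bound := by
    refine ⟨‖e‖ * ‖T‖ + 1, by positivity, fun x₁ x₁' x₂ x₂' => ?_⟩
    have h : mixedDiff (fun x => e (T x)) x₁ x₁' x₂ x₂' = e (mixedDiff T x₁ x₁' x₂ x₂') := by
      simp only [mixedDiff, map_sub, map_add]
    rw [h]
    have h1 : ‖e (mixedDiff T x₁ x₁' x₂ x₂')‖
        ≤ ‖e‖ * (‖T‖ * (dist x₁ x₁' * dist x₂ x₂')) :=
      (e.le_opNorm _).trans
        (mul_le_mul_of_nonneg_left (T.norm_mixedDiff_le _ _ _ _) (norm_nonneg _))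
    have h2 : 0 ≤ dist x₁ x₁' * dist x₂ x₂' := by positivity
    nlinarith
  map_zero_right := fun x => by simp [T.map_zero_right]
  map_zero_left := fun x => by simp [T.map_zero_left]

instance : SMul 𝕜 (BLip₀ X₁ X₂ E) :=
  ⟨fun c T =>
   { toFun := fun x => c • T x
     exists_bound := by
       refine ⟨‖c‖ * ‖T‖ + 1, by positivity, fun x₁ x₁' x₂ x₂' => ?_⟩
       rw [mixedDiff_smul, norm_smul]
       have h1 := mul_le_mul_of_nonneg_left (T.norm_mixedDiff_le x₁ x₁' x₂ x₂') (norm_nonneg c)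
       have h2 : 0 ≤ dist x₁ x₁' * dist x₂ x₂' := by positivity
       nlinarith
     map_zero_right := fun x => by simp [T.map_zero_right]
     map_zero_left := fun x => by simp [T.map_zero_left] }⟩

@[simp] theorem smul_apply (c : 𝕜) (T : BLip₀ X₁ X₂ E) (x : X₁ × X₂) : (c • T) x = c • T x := rfl

instance : Module 𝕜 (BLip₀ X₁ X₂ E) where
  one_smul T := by ext x; exact one_smul _ _
  mul_smul a b T := by ext x; exact mul_smul _ _ _
  smul_zero a := by ext x; exact smul_zero _
  smul_add a S T := by ext x; exact smul_add _ _ _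
  add_smul a b T := by ext x; exact add_smul _ _ _
  zero_smul T := by ext x; exact zero_smul _ _

noncomputable instance : NormedSpace 𝕜 (BLip₀ X₁ X₂ E) where
  norm_smul_le c T := by
    refine norm_le_of_bound _ (mul_nonneg (norm_nonneg _) (norm_nonneg _)) fun x₁ x₁' x₂ x₂' => ?_
    have h : mixedDiff (c • T) x₁ x₁' x₂ x₂' = c • mixedDiff T x₁ x₁' x₂ x₂' :=
      mixedDiff_smul c T x₁ x₁' x₂ x₂'
    rw [h, norm_smul, mul_assoc]
    exact mul_le_mul_of_nonneg_left (T.norm_mixedDiff_le _ _ _ _) (norm_nonneg _)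

variable (𝕜) in
/-- The set `Im_BLip(T)` of the difference quotients of `T`, a subset of `E`. -/
def imBLip (T : BLip₀ X₁ X₂ E) : Set E :=
  {e | ∃ (x₁ x₁' : X₁) (x₂ x₂' : X₂), x₁ ≠ x₁' ∧ x₂ ≠ x₂' ∧
    e = ((dist x₁ x₁' * dist x₂ x₂' : ℝ) : 𝕜)⁻¹ • mixedDiff T x₁ x₁' x₂ x₂'}

variable (𝕜) in
/-- A two-Lipschitz operator is compact if `Im_BLip(T)` is relatively compact in `E`. -/
def IsCompactTwoLipschitz (T : BLip₀ X₁ X₂ E) : Prop :=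
  IsCompact (closure (T.imBLip 𝕜))

variable (𝕜) in
/-- The transpose `Tᵗ : E* → BLip₀(X₁, X₂; 𝕜)`, `e ↦ e ∘ T`, of a two-Lipschitz operator. -/
noncomputable def transpose (T : BLip₀ X₁ X₂ E) : StrongDual 𝕜 E →L[𝕜] BLip₀ X₁ X₂ 𝕜 :=
  LinearMap.mkContinuous
    { toFun := fun e => compDual e T
      map_add' := fun e f => by ext x; rfl
      map_smul' := fun c e => by ext x; rfl } ‖T‖ (fun e => by
    refine norm_le_of_bound _ (mul_nonneg (norm_nonneg _) (norm_nonneg _)) fun x₁ x₁' x₂ x₂' => ?_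
    have h : mixedDiff (compDual e T) x₁ x₁' x₂ x₂' = e (mixedDiff T x₁ x₁' x₂ x₂') := by
      simp only [mixedDiff, compDual, map_sub, map_add]
    change ‖mixedDiff (compDual e T) x₁ x₁' x₂ x₂'‖ ≤ _
    rw [h, mul_comm ‖T‖, mul_assoc]
    exact (e.le_opNorm _).trans
      (mul_le_mul_of_nonneg_left (T.norm_mixedDiff_le _ _ _ _) (norm_nonneg _)))

theorem transpose_apply (T : BLip₀ X₁ X₂ E) (e : StrongDual 𝕜 E) (x : X₁ × X₂) :
    T.transpose 𝕜 e x = e (T x) := rfl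

end Scalars

end BLip₀

/-! This is Schauder's theorem with `Im_BLip(T)` in the role of the image of the unit ball. Both
directions rest on `LinearMap.isCompact_image_closedBall_of_totallyBounded`: dual balls are weak-*
compact (Banach–Alaoglu), and on them a linear map dominated by the sup over a totally bounded set
is weak-*-to-norm continuous. Forward, `‖Tᵗ e‖` is dominated by the sup of `‖e‖` over `Im_BLip(T)`.
Backward, the adjoint `φ ↦ φ ∘ Tᵗ` is dominated by the sup over the image of the unit ball under
`Tᵗ`. Its image of the unit ball is then compact in `E**` and contains the canonical copy of
`Im_BLip(T)`; completeness of `E` brings compactness back to `E`. -/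

open Metric Topology

/-- If `‖P φ‖` is controlled by the supremum of `‖φ‖` on a totally bounded set, then the linear
map `P` on the dual space maps closed balls to compact sets. -/
theorem LinearMap.isCompact_image_closedBall_of_totallyBounded {𝕜 V W : Type*} [RCLike 𝕜]
    [NormedAddCommGroup V] [NormedSpace 𝕜 V] [NormedAddCommGroup W] [NormedSpace 𝕜 W]
    {M : Set V} (hM : TotallyBounded M) (P : StrongDual 𝕜 V →ₗ[𝕜] W)
    (hP : ∀ (φ : StrongDual 𝕜 V) (c : ℝ), 0 ≤ c → (∀ m ∈ M, ‖φ m‖ ≤ c) → ‖P φ‖ ≤ c) (r : ℝ) :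
    IsCompact (P '' closedBall 0 r) := by
  have hB : IsCompact (WeakDual.toStrongDual ⁻¹' closedBall (0 : StrongDual 𝕜 V) r) :=
    WeakDual.isCompact_closedBall 0 r
  have hc : ContinuousOn (fun φ : WeakDual 𝕜 V => P (WeakDual.toStrongDual φ))
      (WeakDual.toStrongDual ⁻¹' closedBall (0 : StrongDual 𝕜 V) r) := by
    intro φ hφ
    have hφr : ‖WeakDual.toStrongDual φ‖ ≤ r := by simpa using hφ
    have hr : 0 ≤ r := (norm_nonneg _).trans hφr
    rw [ContinuousWithinAt, Metric.tendsto_nhds]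
    intro ε hε
    -- Differences of functionals in the ball have norm at most `2 * (r + 1)`, so this mesh costs `ε
    -- / 4`; the `+ 1` covers `r = 0`. Only finitely many evaluations remain, and weak-* closeness
    -- controls these.
    obtain ⟨t, ht, hcov⟩ := Metric.totallyBounded_iff.1 hM (ε / (8 * (r + 1))) (by positivity)
    have hev : ∀ᶠ ψ : WeakDual 𝕜 V in 𝓝 φ, ∀ s ∈ t, dist (ψ s) (φ s) < ε / 4 :=
      (Filter.eventually_all_finite ht).2 fun s _ =>
        Metric.tendsto_nhds.1 (WeakDual.eval_continuous s).continuousAt _ (by positivity)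
    filter_upwards [nhdsWithin_le_nhds hev, self_mem_nhdsWithin] with ψ hψ hψB
    have hψr : ‖WeakDual.toStrongDual ψ‖ ≤ r := by simpa using hψB
    rw [dist_eq_norm, ← map_sub]
    refine lt_of_le_of_lt (hP _ (ε / 2) (by positivity) fun m hm => ?_) (half_lt_self hε)
    obtain ⟨s, hs, hms⟩ := Set.mem_iUnion₂.1 (hcov hm)
    rw [mem_ball, dist_eq_norm] at hms
    set χ := WeakDual.toStrongDual ψ - WeakDual.toStrongDual φ with hχ
    have hχr : ‖χ‖ ≤ 2 * (r + 1) := (norm_sub_le _ _).trans (by linarith)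
    have h₁ : ‖χ (m - s)‖ ≤ ε / 4 := by
      refine (χ.le_of_opNorm_le_of_le hχr hms.le).trans_eq ?_
      field_simp
      norm_num
    have h₂ : ‖χ s‖ ≤ ε / 4 := by
      have := (hψ s hs).le
      rwa [dist_eq_norm] at this
    calc ‖χ m‖ = ‖χ (m - s) + χ s‖ := by rw [← map_add, sub_add_cancel]
      _ ≤ ε / 4 + ε / 4 := norm_add_le_of_le h₁ h₂
      _ = ε / 2 := by ring
  convert hB.image_of_continuousOn hc using 1
  ext w
  constructor
  · rintro ⟨φ, hφ, rfl⟩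
    exact ⟨StrongDual.toWeakDual φ, hφ, rfl⟩
  · rintro ⟨φ, hφ, rfl⟩
    exact ⟨WeakDual.toStrongDual φ, hφ, rfl⟩

namespace BLip₀

variable {𝕜 : Type*} [RCLike 𝕜] {X₁ X₂ E : Type*}
  [MetricSpace X₁] [Zero X₁] [MetricSpace X₂] [Zero X₂] [NormedAddCommGroup E] [NormedSpace 𝕜 E]

theorem mixedDiff_transpose (T : BLip₀ X₁ X₂ E) (e : StrongDual 𝕜 E) (x₁ x₁' : X₁) (x₂ x₂' : X₂) :
    mixedDiff (T.transpose 𝕜 e) x₁ x₁' x₂ x₂' = e (mixedDiff T x₁ x₁' x₂ x₂') := by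
  simp only [mixedDiff, transpose_apply, map_sub, map_add]

/-- Mixed differences vanish when two points coincide, so only genuine quotients matter. `0 ≤ c` is
needed when there are none. -/
theorem norm_transpose_le (T : BLip₀ X₁ X₂ E) (e : StrongDual 𝕜 E) {c : ℝ} (hc : 0 ≤ c)
    (h : ∀ m ∈ T.imBLip 𝕜, ‖e m‖ ≤ c) : ‖T.transpose 𝕜 e‖ ≤ c := by
  refine norm_le_of_bound _ hc fun x₁ x₁' x₂ x₂' => ?_
  rcases eq_or_ne x₁ x₁' with rfl | h₁
  · simp [mixedDiff]
  rcases eq_or_ne x₂ x₂' with rfl | h₂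
  · simp [mixedDiff]
  have hd : 0 < dist x₁ x₁' * dist x₂ x₂' := mul_pos (dist_pos.2 h₁) (dist_pos.2 h₂)
  have := h _ ⟨x₁, x₁', x₂, x₂', h₁, h₂, rfl⟩
  rw [map_smul, norm_smul, norm_inv, RCLike.norm_ofReal, abs_of_pos hd, inv_mul_le_iff₀ hd] at this
  rw [mixedDiff_transpose, mul_comm c]
  exact this

variable (𝕜) in
/-- The functional `R ↦ mixedDiff R x₁ x₁' x₂ x₂'` on the space of two-Lipschitz forms. -/
noncomputable def mixedDiffCLM (x₁ x₁' : X₁) (x₂ x₂' : X₂) : StrongDual 𝕜 (BLip₀ X₁ X₂ 𝕜) :=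
  LinearMap.mkContinuous
    { toFun := fun R => mixedDiff R x₁ x₁' x₂ x₂'
      map_add' := fun R S => by simp only [mixedDiff, add_apply]; ring
      map_smul' := fun c R => mixedDiff_smul c R x₁ x₁' x₂ x₂' }
    (dist x₁ x₁' * dist x₂ x₂') fun R => by
      rw [mul_comm]
      exact R.norm_mixedDiff_le x₁ x₁' x₂ x₂'

theorem norm_mixedDiffCLM_le (x₁ x₁' : X₁) (x₂ x₂' : X₂) :
    ‖mixedDiffCLM 𝕜 x₁ x₁' x₂ x₂'‖ ≤ dist x₁ x₁' * dist x₂ x₂' :=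
  LinearMap.mkContinuous_norm_le _ (by positivity) _

/-- Evaluating `e` at a quotient of `T` is the same as applying the normalised mixed difference, a
functional of norm at most one, to `Tᵗ e`. -/
theorem inclusionInDoubleDual_mem_of_mem_imBLip (T : BLip₀ X₁ X₂ E) {m : E}
    (hm : m ∈ T.imBLip 𝕜) :
    NormedSpace.inclusionInDoubleDualLi 𝕜 m ∈
      (fun φ : StrongDual 𝕜 (BLip₀ X₁ X₂ 𝕜) => φ.comp (T.transpose 𝕜)) '' closedBall 0 1 := by
  obtain ⟨x₁, x₁', x₂, x₂', h₁, h₂, rfl⟩ := hm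
  have hd : 0 < dist x₁ x₁' * dist x₂ x₂' := mul_pos (dist_pos.2 h₁) (dist_pos.2 h₂)
  refine ⟨((dist x₁ x₁' * dist x₂ x₂' : ℝ) : 𝕜)⁻¹ • mixedDiffCLM 𝕜 x₁ x₁' x₂ x₂', ?_, ?_⟩
  · rw [mem_closedBall_zero_iff, norm_smul, norm_inv, RCLike.norm_ofReal, abs_of_pos hd,
      inv_mul_le_iff₀ hd, mul_one]
    exact norm_mixedDiffCLM_le x₁ x₁' x₂ x₂'
  · ext e
    change _ * mixedDiff (T.transpose 𝕜 e) x₁ x₁' x₂ x₂' = e (_ • _)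
    rw [mixedDiff_transpose, map_smul, smul_eq_mul]

theorem IsCompactTwoLipschitz.isCompactOperator_transpose {T : BLip₀ X₁ X₂ E}
    (hT : T.IsCompactTwoLipschitz 𝕜) : IsCompactOperator (T.transpose 𝕜) :=
  (isCompactOperator_iff_image_closedBall_subset_compact
    (T.transpose 𝕜 : StrongDual 𝕜 E →ₗ[𝕜] BLip₀ X₁ X₂ 𝕜) one_pos).2
    ⟨_, LinearMap.isCompact_image_closedBall_of_totallyBounded
      (hT.totallyBounded.subset subset_closure) _
      (fun e _ hc h => T.norm_transpose_le e hc h) 1, subset_rfl⟩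

theorem isCompactTwoLipschitz_of_isCompactOperator_transpose [CompleteSpace E]
    {T : BLip₀ X₁ X₂ E} (hT : IsCompactOperator (T.transpose 𝕜)) :
    T.IsCompactTwoLipschitz 𝕜 := by
  have hM : TotallyBounded (T.transpose 𝕜 '' closedBall 0 1) :=
    (IsCompactOperator.isCompact_closure_image_closedBall
      (f := (T.transpose 𝕜 : StrongDual 𝕜 E →ₗ[𝕜] BLip₀ X₁ X₂ 𝕜)) hT 1).totallyBounded.subset
      subset_closure
  have hK := LinearMap.isCompact_image_closedBall_of_totallyBounded hM
    { toFun := fun φ : StrongDual 𝕜 (BLip₀ X₁ X₂ 𝕜) => φ.comp (T.transpose 𝕜)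
      map_add' := fun φ ψ => rfl
      map_smul' := fun c φ => rfl }
    (fun φ c hc h => ContinuousLinearMap.opNorm_le_of_unit_norm
      (f := φ.comp (T.transpose 𝕜)) hc fun e he =>
      h _ ⟨e, by simp [he], rfl⟩) 1
  -- Completeness of `E` makes the range of this isometry closed, so preimages of compact sets are
  -- compact.
  have hJ : IsClosedEmbedding (NormedSpace.inclusionInDoubleDualLi (E := E) 𝕜) :=
    (LinearIsometry.isometry _).isUniformInducing.isUniformEmbedding.isClosedEmbedding
  exact (hJ.isCompact_preimage hK).closure_of_subset
    fun m hm => T.inclusionInDoubleDual_mem_of_mem_imBLip hm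

end BLip₀

theorem mainTheorem2 {𝕜 : Type*} [RCLike 𝕜] {X₁ X₂ E : Type*}
    [MetricSpace X₁] [Zero X₁] [MetricSpace X₂] [Zero X₂]
    [NormedAddCommGroup E] [NormedSpace 𝕜 E] [CompleteSpace E]
    (T : BLip₀ X₁ X₂ E) :
    T.IsCompactTwoLipschitz 𝕜 ↔ IsCompactOperator (T.transpose 𝕜) :=
  ⟨BLip₀.IsCompactTwoLipschitz.isCompactOperator_transpose,
    BLip₀.isCompactTwoLipschitz_of_isCompactOperator_transpose⟩
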